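/- For an inclusion $H\subseteq G$ of discrete groups, let $\Gamma$ be the semigroup of all $g\in G$ (the one sided quasi-normalizers of $H$ in $G$) for which there are finitely many $g_1,\dots,g_n\in G$ with $Hg\subseteq\bigcup_{i=1}^n g_iH$. Let $H_1=\Gamma\cap\Gamma^{-1}$, the largest subgroup of $G$ contained in $\Gamma$, and let $H_2$ be the subgroup of $G$ generated by $\Gamma$. For an inclusion $B\subseteq M$ of von Neumann algebras, a one sided quasi-normalizer of $B$ in $M$ is an element $x\in M$ for which there are finitely many $x_1,\dots,x_n\in M$ with $Bx\subseteq\sum_{i=1}^n x_iB$; it is a quasi-normalizer if $x_1,\dots,x_n\in M$ can be chosen so that both $Bx\subseteq\sum_{i=1}^n x_iB$ and $xB\subseteq\sum_{i=1}^n Bx_i$. Write $q\mathcal N^{(1)}_M(B)$ and $q\mathcal N_M(B)$ for the sets of one sided quasi-normalizers and of quasi-normalizers, and $W^*(q\mathcal N^{(1)}_M(B))$ and $q\mathcal N_M(B)''$ for the von Neumann algebras they generate (the one sided quasi-normalizer algebra and the quasi-normalizer algebra of $B$ in $M$). Let $L(G)$ be the von Neumann algebra on $\ell^2(G)$ generated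 by the left translations $\lambda_g$, $g\in G$, and let $L(H)\subseteq L(G)$ be the von Neumann subalgebra generated by $\{\lambda_h: h\in H\}$. Let $\mathbb F_\infty$ be the free group on generators $\{g_i: i\in\mathbb Z\}$, let $\mathbb Z$ act on $\mathbb F_\infty$ through the powers of the automorphism $g_i\mapsto g_{i+1}$, let $G=\mathbb F_\infty\rtimes\mathbb Z$, let $t\in G$ be the generator of $\mathbb Z$ (so that $tg_it^{-1}=g_{i+1}$), and let $H$ be the subgroup of $G$ generated by $\{g_i: i\ge 0\}$. Then $t^{-1}\in H_2$ and $t^{-1}\notin H_1$; in particular $H_1\subsetneq H_2$. Moreover $$q\mathcal N_{L(G)}(L(H))''\subsetneq W^*\big(q\mathcal N^{(1)}_{L(G)}(L(H))\big),$$ that is, the one sided quasi-normalizer algebra of $L(H)$ in $L(G)$ strictly contains its quasi-normalizer algebra. -/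

import Mathlib

noncomputable section

/-! ### Group von Neumann algebras -/

/-- The Hilbert space `ℓ²(G)` of a discrete group. -/
abbrev EllTwo (G : Type*) : Type _ := lp (fun _ : G => ℂ) 2

theorem memlp_leftTranslate {G : Type*} [Group G] (g : G) (f : EllTwo G) :
    Memℓp (fun x => (f : G → ℂ) (g⁻¹ * x)) 2 := by
  have h := (memℓp_gen_iff (p := 2) (by norm_num)).1 (lp.memℓp f)
  exact memℓp_gen (h.comp_injective (mul_right_injective g⁻¹))

/-- The left translation `(λ_g f)(x) = f (g⁻¹ x)` as a linear isometry of `ℓ²(G)`; it sends the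
basis vector at `k` to the basis vector at `g k`. -/
def leftTranslate {G : Type*} [Group G] (g : G) : EllTwo G →ₗᵢ[ℂ] EllTwo G where
  toFun f := ⟨fun x => (f : G → ℂ) (g⁻¹ * x), memlp_leftTranslate g f⟩
  map_add' _ _ := rfl
  map_smul' _ _ := rfl
  norm_map' f := by
    rw [lp.norm_eq_tsum_rpow (by norm_num), lp.norm_eq_tsum_rpow (by norm_num)]
    congr 1
    exact (Equiv.mulLeft g⁻¹).tsum_eq
      (fun x => ‖(f : G → ℂ) x‖ ^ (2 : ENNReal).toReal)

/-- The left regular representation `g ↦ λ_g` of `G` on `ℓ²(G)`. -/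
def leftRegular {G : Type*} [Group G] (g : G) : EllTwo G →L[ℂ] EllTwo G :=
  (leftTranslate g).toContinuousLinearMap

theorem leftRegular_apply {G : Type*} [Group G] (g : G) (f : EllTwo G) (x : G) :
    (leftRegular g f : G → ℂ) x = (f : G → ℂ) (g⁻¹ * x) := rfl

/-- The von Neumann algebra generated by a set `S` of operators: the double commutant of
`S ∪ S*`. -/
def vonNeumannGenerated {E : Type*} [NormedAddCommGroup E] [InnerProductSpace ℂ E]
    [CompleteSpace E] (S : Set (E →L[ℂ] E)) : VonNeumannAlgebra E where
  toStarSubalgebra := StarSubalgebra.centralizer ℂ (Set.centralizer (S ∪ star S))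
  centralizer_centralizer' := by
    have h : star (Set.centralizer (S ∪ star S)) = Set.centralizer (S ∪ star S) := by
      rw [Set.star_centralizer, Set.union_star, star_star, Set.union_comm]
    change Set.centralizer (Set.centralizer
        ((StarSubalgebra.centralizer ℂ (Set.centralizer (S ∪ star S)) :
          StarSubalgebra ℂ (E →L[ℂ] E)) : Set (E →L[ℂ] E)))
      = ((StarSubalgebra.centralizer ℂ (Set.centralizer (S ∪ star S)) :
          StarSubalgebra ℂ (E →L[ℂ] E)) : Set (E →L[ℂ] E))
    rw [StarSubalgebra.coe_centralizer, h, Set.union_self]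
    simp

theorem coe_vonNeumannGenerated {E : Type*} [NormedAddCommGroup E] [InnerProductSpace ℂ E]
    [CompleteSpace E] (S : Set (E →L[ℂ] E)) :
    (vonNeumannGenerated S : Set (E →L[ℂ] E)) =
      Set.centralizer (Set.centralizer (S ∪ star S)) := by
  have h : star (Set.centralizer (S ∪ star S)) = Set.centralizer (S ∪ star S) := by
    rw [Set.star_centralizer, Set.union_star, star_star, Set.union_comm]
  change ((StarSubalgebra.centralizer ℂ (Set.centralizer (S ∪ star S)) :
          StarSubalgebra ℂ (E →L[ℂ] E)) : Set (E →L[ℂ] E)) = _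
  rw [StarSubalgebra.coe_centralizer, h, Set.union_self]

/-- `L(K)` for a subgroup `K` of `G`, as a von Neumann subalgebra of `L(G)` acting on `ℓ²(G)`. -/
def subgroupVN {G : Type*} [Group G] (K : Subgroup G) : VonNeumannAlgebra (EllTwo G) :=
  vonNeumannGenerated (leftRegular '' (K : Set G))

/-- The group von Neumann algebra `L(G)`, generated by all the `λ_g`. -/
def groupVN (G : Type*) [Group G] : VonNeumannAlgebra (EllTwo G) :=
  vonNeumannGenerated (Set.range leftRegular)

/-! ### Quasi-normalizers of an inclusion `B ⊆ M` of von Neumann algebras -/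

section QuasiNormalizers

variable {E : Type*} [NormedAddCommGroup E] [InnerProductSpace ℂ E] [CompleteSpace E]

/-- The one sided quasi-normalizers: those `x ∈ M` for which there are
`x₁, …, xₙ ∈ M` with `B x ⊆ ∑ i, xᵢ B`. -/
def oneSidedQN (B M : VonNeumannAlgebra E) : Set (E →L[ℂ] E) :=
  {x | x ∈ M ∧ ∃ (n : ℕ) (y : Fin n → (E →L[ℂ] E)), (∀ i, y i ∈ M) ∧
    ∀ b ∈ B, ∃ c : Fin n → (E →L[ℂ] E), (∀ i, c i ∈ B) ∧ b * x = ∑ i, y i * c i}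

/-- The quasi-normalizers: those `x ∈ M` for which there are `x₁, …, xₙ ∈ M` with both
`B x ⊆ ∑ i, xᵢ B` and `x B ⊆ ∑ i, B xᵢ`. -/
def twoSidedQN (B M : VonNeumannAlgebra E) : Set (E →L[ℂ] E) :=
  {x | x ∈ M ∧ ∃ (n : ℕ) (y : Fin n → (E →L[ℂ] E)), (∀ i, y i ∈ M) ∧
    (∀ b ∈ B, ∃ c : Fin n → (E →L[ℂ] E), (∀ i, c i ∈ B) ∧ b * x = ∑ i, y i * c i) ∧
    (∀ b ∈ B, ∃ c : Fin n → (E →L[ℂ] E), (∀ i, c i ∈ B) ∧ x * b = ∑ i, c i * y i)}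

/-- The one sided quasi-normalizer algebra of `B` in `M`. -/
def oneSidedQNAlgebra (B M : VonNeumannAlgebra E) : VonNeumannAlgebra E :=
  vonNeumannGenerated (oneSidedQN B M)

/-- The quasi-normalizer algebra of `B` in `M`. -/
def twoSidedQNAlgebra (B M : VonNeumannAlgebra E) : VonNeumannAlgebra E :=
  vonNeumannGenerated (twoSidedQN B M)

end QuasiNormalizers

/-! ### Quasi-normalizers of an inclusion `H ⊆ G` of groups -/

/-- The semigroup `Γ` of one sided quasi-normalizers of `H` in `G`: those `g` for which there
are `g₁, …, gₙ ∈ G` with `H g ⊆ ⋃ i, gᵢ H`. -/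
def groupOneSidedQN {G : Type*} [Group G] (H : Subgroup G) : Submonoid G where
  carrier := {g | ∃ (n : ℕ) (y : Fin n → G), ∀ h ∈ H, ∃ i, ∃ h' ∈ H, h * g = y i * h'}
  one_mem' := ⟨1, fun _ => 1, fun h hh => ⟨0, h, hh, by simp⟩⟩
  mul_mem' := by
    rintro a b ⟨n, y, hy⟩ ⟨m, z, hz⟩
    refine ⟨n * m, fun k => y (finProdFinEquiv.symm k).1 * z (finProdFinEquiv.symm k).2, ?_⟩
    intro h hh
    obtain ⟨i, h', hh', e⟩ := hy h hh
    obtain ⟨j, h'', hh'', e'⟩ := hz h' hh'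
    refine ⟨finProdFinEquiv (i, j), h'', hh'', ?_⟩
    simp only [Equiv.symm_apply_apply]
    rw [← mul_assoc, e, mul_assoc, e', mul_assoc]

/-- `H₁ = Γ ∩ Γ⁻¹`, the largest subgroup contained in `Γ`. -/
def groupQN {G : Type*} [Group G] (H : Subgroup G) : Subgroup G where
  carrier := {g | g ∈ groupOneSidedQN H ∧ g⁻¹ ∈ groupOneSidedQN H}
  one_mem' := ⟨one_mem _, by simp⟩
  mul_mem' := by
    rintro a b ⟨ha, ha'⟩ ⟨hb, hb'⟩
    exact ⟨mul_mem ha hb, by rw [mul_inv_rev]; exact mul_mem hb' ha'⟩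
  inv_mem' := by
    rintro a ⟨ha, ha'⟩
    exact ⟨ha', by rwa [inv_inv]⟩

/-- `H₂`, the subgroup of `G` generated by `Γ`. -/
def groupOneSidedQNClosure {G : Type*} [Group G] (H : Subgroup G) : Subgroup G :=
  Subgroup.closure (groupOneSidedQN H : Set G)

/-! ### The group `F_∞ ⋊ ℤ` -/

namespace ShiftExample

/-- The automorphism `g_i ↦ g_{i+1}` of the free group on `{g_i : i ∈ ℤ}`. -/
def shift : MulAut (FreeGroup ℤ) := FreeGroup.freeGroupCongr (Equiv.addRight 1)

/-- The action `n ↦ shift ^ n` of `ℤ`. -/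
def shiftAction : Multiplicative ℤ →* MulAut (FreeGroup ℤ) := zpowersHom _ shift

/-- `G = F_∞ ⋊ ℤ`. -/
abbrev G : Type := FreeGroup ℤ ⋊[shiftAction] Multiplicative ℤ

/-- The generator `g_i` of `F_∞`, in `G`. -/
def gen (i : ℤ) : G := SemidirectProduct.inl (FreeGroup.of i)

/-- The generator `t` of `ℤ`, in `G`. -/
def t : G := SemidirectProduct.inr (Multiplicative.ofAdd 1)

/-- The subgroup of `G` generated by the `g_i` with `i ≥ 0`. -/
def H : Subgroup G := Subgroup.closure {x | ∃ i : ℤ, 0 ≤ i ∧ x = gen i}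

theorem t_mul_gen (i : ℤ) : t * gen i * t⁻¹ = gen (i + 1) := by
  rw [t, gen, ← map_inv, ← SemidirectProduct.inl_aut]
  simp [shiftAction, shift]
  rfl

end ShiftExample

end

/-! Conjugation by `t` maps `H` into itself, so `H t⁻¹ ⊆ t⁻¹ H`; the same computation in `L(G)`
makes `λ(t⁻¹)` a one sided quasi-normalizer. In the other direction, if `g` has positive degree `n`
(the exponent of `t`), then `g⁻¹ g_0 g` is conjugate in `F_∞` to `g_{-n}`, no nonzero power of which
is conjugate there into `H`. Hence the cosets `g_0 ^ k g H` are distinct and `g ∉ Γ`; in particular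
`t ∉ Γ`.

The analytic counterpart is `coefficient_eq_zero`. Write `λ(u_k) x = ∑ y_i c_i` with the `c_i`
bounded uniformly in `k`, by the open mapping theorem. The coefficient of `x` at `g` is that of
`λ(u_k) x` at `u_k g`, so it is at most a constant times the sum over `i` of the `ℓ²` norms of `y_i
δ_1` on the coset `u_k g K`. For distinct cosets these norms tend to zero.

One sided quasi-normalizers therefore have no coefficients in positive degree. Two sided ones are
closed under adjoints, so they have none in negative degree either, and they all commute with the
projection onto `ℓ²(F_∞)`. Their double commutant then commutes with it too, but `λ(t⁻¹)` does not.
-/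

open Filter Topology ComplexConjugate

/-! ### Coordinates in `ℓ²(G)` -/

section Coordinates

variable {G : Type*}

open Classical in
/-- The basis vector of `ℓ²(G)` at `k`. -/
noncomputable def delta (k : G) : EllTwo G := lp.single 2 k (1 : ℂ)

theorem delta_self (k : G) : (delta k : G → ℂ) k = 1 := by
  classical simp [delta]

theorem delta_of_ne {k s : G} (h : s ≠ k) : (delta k : G → ℂ) s = 0 := by
  classical simp [delta, h]

theorem norm_delta (k : G) : ‖delta k‖ = 1 := by
  classical
  rw [delta, lp.norm_single (by norm_num), norm_one]

theorem inner_delta_left (k : G) (f : EllTwo G) : inner ℂ (delta k) f = (f : G → ℂ) k := by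
  classical
  rw [delta, lp.inner_single_left]
  simp

theorem inner_delta_right (k : G) (f : EllTwo G) :
    inner ℂ f (delta k) = conj ((f : G → ℂ) k) := by
  rw [← inner_delta_left, inner_conj_symm]

theorem eq_of_delta {S T : EllTwo G →L[ℂ] EllTwo G} (h : ∀ k, S (delta k) = T (delta k)) :
    S = T := by
  classical
  ext1 f
  have hf := lp.hasSum_single (p := 2) (by norm_num) f
  have hk : ∀ k, S (lp.single 2 k ((f : G → ℂ) k)) = T (lp.single 2 k ((f : G → ℂ) k)) := by
    intro k
    have e : lp.single 2 k ((f : G → ℂ) k) = (f : G → ℂ) k • delta k := by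
      rw [delta, ← lp.single_smul, smul_eq_mul, mul_one]
    rw [e, map_smul, map_smul, h]
  have h1 := S.hasSum hf
  simp only [hk] at h1
  exact h1.unique (T.hasSum hf)

theorem summable_norm_sq (f : EllTwo G) : Summable fun x => ‖(f : G → ℂ) x‖ ^ 2 := by
  simpa using (lp.memℓp f).summable (by norm_num)

theorem norm_sq_eq_tsum (f : EllTwo G) : ‖f‖ ^ 2 = ∑' x, ‖(f : G → ℂ) x‖ ^ 2 := by
  simpa using lp.norm_rpow_eq_tsum (p := 2) (by norm_num) f

/-! ### Multiplication by an indicator function -/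

/-- The projection of `ℓ²(G)` onto the functions supported in `s`. -/
noncomputable def restrictTo (s : Set G) : EllTwo G →L[ℂ] EllTwo G :=
  LinearMap.mkContinuous
    { toFun := fun f => ⟨s.indicator (f : G → ℂ),
        (lp.memℓp f).mono' fun x => norm_indicator_le_norm_self _ _⟩
      map_add' := fun f g => lp.ext (Set.indicator_add s f g)
      map_smul' := fun c f => lp.ext (Set.indicator_const_smul s c f) }
    1 fun f => by
      rw [one_mul]
      exact lp.norm_mono (by norm_num) fun x => norm_indicator_le_norm_self _ _

theorem restrictTo_apply (s : Set G) (f : EllTwo G) :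
    (restrictTo s f : G → ℂ) = s.indicator (f : G → ℂ) := rfl

theorem restrictTo_delta_of_mem {s : Set G} {k : G} (h : k ∈ s) :
    restrictTo s (delta k) = delta k := by
  apply lp.ext
  rw [restrictTo_apply, Set.indicator_eq_self]
  intro x hx
  by_contra hxs
  exact hx (delta_of_ne fun e => hxs (e ▸ h))

theorem restrictTo_delta_of_notMem {s : Set G} {k : G} (h : k ∉ s) :
    restrictTo s (delta k) = 0 := by
  apply lp.ext
  rw [restrictTo_apply, lp.coeFn_zero]
  refine Set.indicator_eq_zero'.2 (Set.disjoint_left.2 ?_)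
  intro x hx hxs
  exact hx (delta_of_ne fun e => h (e ▸ hxs))

theorem inner_restrictTo_right (s : Set G) (f g : EllTwo G) :
    inner ℂ f (restrictTo s g) = inner ℂ (restrictTo s f) g := by
  rw [lp.inner_eq_tsum, lp.inner_eq_tsum]
  refine tsum_congr fun x => ?_
  rw [restrictTo_apply, restrictTo_apply]
  by_cases h : x ∈ s <;> simp [h]

theorem star_apply_delta_apply (x : EllTwo G →L[ℂ] EllTwo G) (k s : G) :
    (star x (delta k) : G → ℂ) s = conj ((x (delta s) : G → ℂ) k) := by
  rw [← inner_delta_left, ContinuousLinearMap.star_eq_adjoint,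
    ContinuousLinearMap.adjoint_inner_right, inner_delta_right]

end Coordinates

section Translations

variable {G : Type*} [Group G]

/-! ### Translations -/

theorem leftRegular_delta (g k : G) : leftRegular g (delta k) = delta (g * k) := by
  apply lp.ext
  funext x
  rw [leftRegular_apply]
  by_cases h : x = g * k
  · subst h
    rw [inv_mul_cancel_left, delta_self, delta_self]
  · rw [delta_of_ne h, delta_of_ne]
    rintro rfl
    simp at h

theorem leftRegular_mul (a b : G) : leftRegular a * leftRegular b = leftRegular (a * b) :=
  eq_of_delta fun k => by
    rw [mul_apply_eq_comp, leftRegular_delta, leftRegular_delta, leftRegular_delta,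
      mul_assoc]

theorem leftRegular_one : leftRegular (1 : G) = 1 :=
  eq_of_delta fun k => by simp [leftRegular_delta]

theorem star_leftRegular (g : G) : star (leftRegular g) = leftRegular g⁻¹ := by
  refine eq_of_delta fun k => lp.ext (funext fun x => ?_)
  rw [← inner_delta_left, ContinuousLinearMap.star_eq_adjoint,
    ContinuousLinearMap.adjoint_inner_right, leftRegular_delta, leftRegular_delta,
    inner_delta_left]
  by_cases h : g * x = k
  · subst h
    rw [delta_self, inv_mul_cancel_left, delta_self]
  · rw [delta_of_ne h, delta_of_ne]
    rintro rfl
    simp at h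

theorem norm_leftRegular_le (g : G) : ‖leftRegular g‖ ≤ 1 :=
  (leftTranslate g).norm_toContinuousLinearMap_le

theorem memlp_rightTranslate (g : G) (f : EllTwo G) :
    Memℓp (fun x => (f : G → ℂ) (x * g)) 2 := by
  have h := (memℓp_gen_iff (p := 2) (by norm_num)).1 (lp.memℓp f)
  exact memℓp_gen (h.comp_injective (mul_left_injective g))

/-- The right translation `(ρ_g f)(x) = f (x g)` as a linear isometry of `ℓ²(G)`. -/
noncomputable def rightTranslate (g : G) : EllTwo G →ₗᵢ[ℂ] EllTwo G where
  toFun f := ⟨fun x => (f : G → ℂ) (x * g), memlp_rightTranslate g f⟩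
  map_add' _ _ := rfl
  map_smul' _ _ := rfl
  norm_map' f := by
    rw [lp.norm_eq_tsum_rpow (by norm_num), lp.norm_eq_tsum_rpow (by norm_num)]
    congr 1
    exact (Equiv.mulRight g).tsum_eq
      (fun x => ‖(f : G → ℂ) x‖ ^ (2 : ENNReal).toReal)

/-- The right regular representation of `G` on `ℓ²(G)`. -/
noncomputable def rightRegular (g : G) : EllTwo G →L[ℂ] EllTwo G :=
  (rightTranslate g).toContinuousLinearMap

theorem rightRegular_apply (g : G) (f : EllTwo G) (x : G) :
    (rightRegular g f : G → ℂ) x = (f : G → ℂ) (x * g) := rfl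

theorem rightRegular_delta (g k : G) : rightRegular g (delta k) = delta (k * g⁻¹) := by
  apply lp.ext
  funext x
  rw [rightRegular_apply]
  by_cases h : x = k * g⁻¹
  · subst h
    rw [inv_mul_cancel_right, delta_self, delta_self]
  · rw [delta_of_ne h, delta_of_ne]
    rintro rfl
    simp at h

/-- Left translation by `k ∈ K` preserves both `K` and its complement. This puts the projection onto
`ℓ²(K)` in the commutant of `L(K)`. -/
theorem restrictTo_mul_leftRegular (K : Subgroup G) {k : G} (hk : k ∈ K) :
    restrictTo (K : Set G) * leftRegular k = leftRegular k * restrictTo (K : Set G) := by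
  refine eq_of_delta fun x => ?_
  rw [mul_apply_eq_comp, mul_apply_eq_comp, leftRegular_delta]
  by_cases hx : x ∈ K
  · rw [restrictTo_delta_of_mem (s := (K : Set G)) hx,
      restrictTo_delta_of_mem (s := (K : Set G)) (K.mul_mem hk hx), leftRegular_delta]
  · rw [restrictTo_delta_of_notMem (s := (K : Set G)) hx, map_zero,
      restrictTo_delta_of_notMem]
    rwa [SetLike.mem_coe, K.mul_mem_cancel_left hk]

end Translations

/-! ### Generated von Neumann algebras -/

section Generated

variable {E : Type*} [NormedAddCommGroup E] [InnerProductSpace ℂ E] [CompleteSpace E]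

theorem mem_vonNeumannGenerated {S : Set (E →L[ℂ] E)} {x : E →L[ℂ] E} :
    x ∈ vonNeumannGenerated S ↔ ∀ T ∈ Set.centralizer (S ∪ star S), T * x = x * T := by
  rw [← SetLike.mem_coe, coe_vonNeumannGenerated, Set.mem_centralizer_iff]

theorem subset_vonNeumannGenerated (S : Set (E →L[ℂ] E)) :
    S ⊆ (vonNeumannGenerated S : Set (E →L[ℂ] E)) := by
  rw [coe_vonNeumannGenerated]
  exact Set.subset_union_left.trans Set.subset_centralizer_centralizer

theorem vonNeumannGenerated_mono {S T : Set (E →L[ℂ] E)} (h : S ⊆ T) :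
    vonNeumannGenerated S ≤ vonNeumannGenerated T := by
  rw [← SetLike.coe_subset_coe, coe_vonNeumannGenerated, coe_vonNeumannGenerated]
  exact Set.centralizer_subset (Set.centralizer_subset
    (Set.union_subset_union h (Set.star_subset_star.2 h)))

theorem isClosed_vonNeumannAlgebra (B : VonNeumannAlgebra E) :
    IsClosed (B : Set (E →L[ℂ] E)) := by
  rw [← B.centralizer_centralizer]
  exact Set.isClosed_centralizer _

theorem smul_mem_vonNeumannAlgebra (B : VonNeumannAlgebra E) (c : ℂ) {x : E →L[ℂ] E}
    (hx : x ∈ B) : c • x ∈ B :=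
  B.toStarSubalgebra.smul_mem hx c

end Generated

/-! ### Coefficients of elements of `L(G)` and `L(K)` -/

section GroupAlgebras

variable {G : Type*} [Group G]

theorem mem_centralizer_leftRegular {K : Subgroup G} {T : EllTwo G →L[ℂ] EllTwo G} :
    T ∈ Set.centralizer (leftRegular '' (K : Set G) ∪ star (leftRegular '' (K : Set G))) ↔
      ∀ k ∈ K, leftRegular k * T = T * leftRegular k := by
  rw [Set.mem_centralizer_iff]
  constructor
  · intro h k hk
    exact h _ (Or.inl ⟨k, hk, rfl⟩)
  · rintro h m (⟨k, hk, rfl⟩ | ⟨k, hk, e⟩)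
    · exact h k hk
    · rw [← star_star m, ← e, star_leftRegular]
      exact h _ (K.inv_mem hk)

theorem groupVN_eq_subgroupVN_top : groupVN G = subgroupVN (⊤ : Subgroup G) := by
  rw [groupVN, subgroupVN, Subgroup.coe_top, Set.image_univ]

theorem leftRegular_mem_subgroupVN {K : Subgroup G} {k : G} (hk : k ∈ K) :
    leftRegular k ∈ subgroupVN K :=
  subset_vonNeumannGenerated _ ⟨k, hk, rfl⟩

theorem leftRegular_mem_groupVN (g : G) : leftRegular g ∈ groupVN G :=
  subset_vonNeumannGenerated _ ⟨g, rfl⟩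

theorem commute_of_mem_subgroupVN {K : Subgroup G} {x T : EllTwo G →L[ℂ] EllTwo G}
    (hx : x ∈ subgroupVN K) (hT : ∀ k ∈ K, leftRegular k * T = T * leftRegular k) :
    T * x = x * T :=
  mem_vonNeumannGenerated.1 hx T (mem_centralizer_leftRegular.2 hT)

/-- An element of `L(G)` is a convolution operator. -/
theorem apply_delta_apply {x : EllTwo G →L[ℂ] EllTwo G} (hx : x ∈ groupVN G) (k s : G) :
    (x (delta k) : G → ℂ) s = (x (delta 1) : G → ℂ) (s * k⁻¹) := by
  rw [groupVN_eq_subgroupVN_top] at hx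
  -- Right translations commute with left ones, hence with all of `L(G)`.
  have h : rightRegular k⁻¹ * x = x * rightRegular k⁻¹ := by
    refine commute_of_mem_subgroupVN hx fun g _ => eq_of_delta fun a => ?_
    simp only [mul_apply_eq_comp, leftRegular_delta, rightRegular_delta, mul_assoc]
  have h1 := congrArg (fun T => (T (delta 1) : G → ℂ) s) h
  simp only [mul_apply_eq_comp, rightRegular_delta, inv_inv, one_mul] at h1
  rw [← h1, rightRegular_apply]

/-- The projection onto `ℓ²(K)` commutes with `c` and fixes `δ_1`: coefficients of elements of
`L(K)` live on `K`. -/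
theorem restrictTo_apply_delta_one {K : Subgroup G} {c : EllTwo G →L[ℂ] EllTwo G}
    (hc : c ∈ subgroupVN K) : restrictTo (K : Set G) (c (delta 1)) = c (delta 1) := by
  have h := commute_of_mem_subgroupVN hc fun k hk => (restrictTo_mul_leftRegular K hk).symm
  have h1 := congrArg (fun T => T (delta 1)) h
  simpa only [mul_apply_eq_comp,
    restrictTo_delta_of_mem (s := (K : Set G)) K.one_mem] using h1

/-- An element of `L(G)` whose coefficients vanish off `K` preserves `ℓ²(K)` and its
complement. -/
theorem restrictTo_commute {K : Subgroup G} {x : EllTwo G →L[ℂ] EllTwo G} (hx : x ∈ groupVN G)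
    (h : ∀ g ∉ K, (x (delta 1) : G → ℂ) g = 0) :
    x * restrictTo (K : Set G) = restrictTo (K : Set G) * x := by
  refine eq_of_delta fun k => ?_
  rw [mul_apply_eq_comp, mul_apply_eq_comp]
  by_cases hk : k ∈ K
  · rw [restrictTo_delta_of_mem (s := (K : Set G)) hk]
    refine lp.ext (Eq.symm ?_)
    rw [restrictTo_apply, Set.indicator_eq_self]
    intro s hs
    by_contra hsK
    refine hs ?_
    rw [apply_delta_apply hx]
    refine h _ fun hmem => hsK ?_
    exact (K.mul_mem_cancel_right (K.inv_mem hk)).1 hmem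
  · rw [restrictTo_delta_of_notMem (s := (K : Set G)) hk, map_zero]
    refine lp.ext (Eq.symm ?_)
    rw [restrictTo_apply, lp.coeFn_zero]
    refine Set.indicator_eq_zero'.2 (Set.disjoint_left.2 ?_)
    intro s hs hsK
    refine hs ?_
    rw [apply_delta_apply hx]
    refine h _ fun hmem => hk ?_
    exact inv_mem_iff.1 ((K.mul_mem_cancel_left hsK).1 hmem)

/-- If `a` conjugates `K` into itself then `L(K) λ(a⁻¹) ⊆ λ(a⁻¹) L(K)`. -/
theorem conj_mem_subgroupVN {K : Subgroup G} {a : G} (ha : ∀ k ∈ K, a * k * a⁻¹ ∈ K)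
    {b : EllTwo G →L[ℂ] EllTwo G} (hb : b ∈ subgroupVN K) :
    leftRegular a * b * leftRegular a⁻¹ ∈ subgroupVN K := by
  refine mem_vonNeumannGenerated.2 fun T hT => ?_
  rw [mem_centralizer_leftRegular] at hT
  have e1 : leftRegular a * leftRegular a⁻¹ = 1 := by
    rw [leftRegular_mul, mul_inv_cancel, leftRegular_one]
  have e2 : leftRegular a⁻¹ * leftRegular a = 1 := by
    rw [leftRegular_mul, inv_mul_cancel, leftRegular_one]
  -- Since `a K a⁻¹ ⊆ K`, conjugating by `λ(a⁻¹)` keeps `T` in the commutant of `L(K)`.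
  have h : leftRegular a⁻¹ * T * leftRegular a * b = b * (leftRegular a⁻¹ * T * leftRegular a) := by
    refine commute_of_mem_subgroupVN hb fun k hk => ?_
    have e3 : leftRegular a * leftRegular k = leftRegular (a * k * a⁻¹) * leftRegular a := by
      rw [leftRegular_mul, leftRegular_mul, inv_mul_cancel_right]
    have e4 : leftRegular k * leftRegular a⁻¹ = leftRegular a⁻¹ * leftRegular (a * k * a⁻¹) := by
      rw [leftRegular_mul, leftRegular_mul]
      congr 1
      group
    calc leftRegular k * (leftRegular a⁻¹ * T * leftRegular a)
        = leftRegular k * leftRegular a⁻¹ * T * leftRegular a := by simp only [mul_assoc]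
      _ = leftRegular a⁻¹ * (leftRegular (a * k * a⁻¹) * T) * leftRegular a := by
        rw [e4]; simp only [mul_assoc]
      _ = leftRegular a⁻¹ * T * (leftRegular (a * k * a⁻¹) * leftRegular a) := by
        rw [hT _ (ha k hk)]; simp only [mul_assoc]
      _ = leftRegular a⁻¹ * T * leftRegular a * leftRegular k := by
        rw [← e3]; simp only [mul_assoc]
  calc T * (leftRegular a * b * leftRegular a⁻¹)
      = leftRegular a * leftRegular a⁻¹ * T * leftRegular a * b * leftRegular a⁻¹ := by
        rw [e1]; simp only [mul_assoc, one_mul]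
    _ = leftRegular a * (leftRegular a⁻¹ * T * leftRegular a * b) * leftRegular a⁻¹ := by
        simp only [mul_assoc]
    _ = leftRegular a * b * leftRegular a⁻¹ * T * (leftRegular a * leftRegular a⁻¹) := by
        rw [h]; simp only [mul_assoc]
    _ = leftRegular a * b * leftRegular a⁻¹ * T := by rw [e1, mul_one]

theorem leftRegular_inv_mem_oneSidedQN {K : Subgroup G} {a : G}
    (ha : ∀ k ∈ K, a * k * a⁻¹ ∈ K) :
    leftRegular a⁻¹ ∈ oneSidedQN (subgroupVN K) (groupVN G) := by
  refine ⟨leftRegular_mem_groupVN _, 1, fun _ => leftRegular a⁻¹,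
    fun _ => leftRegular_mem_groupVN _, fun b hb =>
    ⟨fun _ => leftRegular a * b * leftRegular a⁻¹, fun _ => conj_mem_subgroupVN ha hb, ?_⟩⟩
  rw [Fin.sum_univ_one, ← mul_assoc, ← mul_assoc, leftRegular_mul, inv_mul_cancel,
    leftRegular_one, one_mul]

end GroupAlgebras

/-! ### Quasi-normalizers -/

section QN

variable {E : Type*} [NormedAddCommGroup E] [InnerProductSpace ℂ E] [CompleteSpace E]

theorem twoSidedQN_subset_oneSidedQN (B M : VonNeumannAlgebra E) :
    twoSidedQN B M ⊆ oneSidedQN B M :=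
  fun _ ⟨hx, n, y, hy, h, _⟩ => ⟨hx, n, y, hy, h⟩

/-- Adjoints exchange the two inclusions in the definition. -/
theorem star_mem_twoSidedQN {B M : VonNeumannAlgebra E} {x : E →L[ℂ] E}
    (hx : x ∈ twoSidedQN B M) : star x ∈ twoSidedQN B M := by
  obtain ⟨hxM, n, y, hy, h1, h2⟩ := hx
  refine ⟨star_mem hxM, n, fun i => star (y i), fun i => star_mem (hy i), fun b hb => ?_,
    fun b hb => ?_⟩
  · obtain ⟨c, hc, e⟩ := h2 (star b) (star_mem hb)
    refine ⟨fun i => star (c i), fun i => star_mem (hc i), ?_⟩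
    have := congrArg star e
    simpa only [star_mul, star_star, star_sum] using this
  · obtain ⟨c, hc, e⟩ := h1 (star b) (star_mem hb)
    refine ⟨fun i => star (c i), fun i => star_mem (hc i), ?_⟩
    have := congrArg star e
    simpa only [star_mul, star_star, star_sum] using this

/-- In `B x ⊆ ∑ i, yᵢ B` the coefficients can be chosen with norm control. -/
theorem exists_bounded_coefficients (B : VonNeumannAlgebra E) (x : E →L[ℂ] E) {n : ℕ}
    (y : Fin n → (E →L[ℂ] E))
    (h : ∀ b ∈ B, ∃ c : Fin n → (E →L[ℂ] E), (∀ i, c i ∈ B) ∧ b * x = ∑ i, y i * c i) :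
    ∃ C : ℝ, ∀ b ∈ B, ∃ c : Fin n → (E →L[ℂ] E), (∀ i, c i ∈ B ∧ ‖c i‖ ≤ C * ‖b‖) ∧
      b * x = ∑ i, y i * c i := by
  let B' : Submodule ℂ (E →L[ℂ] E) :=
    { carrier := B
      add_mem' := add_mem
      zero_mem' := zero_mem B
      smul_mem' := fun c _ hb => smul_mem_vonNeumannAlgebra B c hb }
  -- All pairs `(b, c)` solving `b x = ∑ y_i c_i` form a Banach space. It projects onto `B` by
  -- hypothesis, so the open mapping theorem gives preimages with norm control.
  let W : Submodule ℂ ((E →L[ℂ] E) × (Fin n → (E →L[ℂ] E))) :=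
    { carrier := {w | w.1 ∈ B ∧ (∀ i, w.2 i ∈ B) ∧ w.1 * x = ∑ i, y i * w.2 i}
      add_mem' := by
        rintro v w ⟨h1, h2, h3⟩ ⟨h4, h5, h6⟩
        refine ⟨add_mem h1 h4, fun i => add_mem (h2 i) (h5 i), ?_⟩
        simp only [Prod.fst_add, Prod.snd_add, Pi.add_apply, add_mul, mul_add, h3, h6,
          Finset.sum_add_distrib]
      zero_mem' := ⟨zero_mem B, fun _ => zero_mem B, by simp⟩
      smul_mem' := by
        rintro c w ⟨h1, h2, h3⟩
        refine ⟨smul_mem_vonNeumannAlgebra B c h1,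
          fun i => smul_mem_vonNeumannAlgebra B c (h2 i), ?_⟩
        simp only [Prod.smul_fst, Prod.smul_snd, Pi.smul_apply, smul_mul_assoc, mul_smul_comm, h3,
          Finset.smul_sum] }
  have hB' : IsClosed (B' : Set (E →L[ℂ] E)) := isClosed_vonNeumannAlgebra B
  have hW : IsClosed (W : Set ((E →L[ℂ] E) × (Fin n → (E →L[ℂ] E)))) := by
    have e : (W : Set ((E →L[ℂ] E) × (Fin n → (E →L[ℂ] E)))) =
        {w | w.1 ∈ (B : Set (E →L[ℂ] E))} ∩ ((⋂ i, {w | w.2 i ∈ (B : Set (E →L[ℂ] E))}) ∩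
          {w | w.1 * x = ∑ i, y i * w.2 i}) := by
      ext w
      simp only [Set.mem_inter_iff, Set.mem_iInter]
      rfl
    rw [e]
    have hB := isClosed_vonNeumannAlgebra B
    refine (hB.preimage continuous_fst).inter ((isClosed_iInter fun i =>
      hB.preimage (by fun_prop)).inter (isClosed_eq (by fun_prop) (by fun_prop)))
  have : CompleteSpace B' := hB'.completeSpace_coe
  have : CompleteSpace W := hW.completeSpace_coe
  let f : W →L[ℂ] B' :=
    ((ContinuousLinearMap.fst ℂ _ _).comp W.subtypeL).codRestrict B' fun w => w.2.1
  have hf : Function.Surjective f := by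
    rintro ⟨b, hb⟩
    obtain ⟨c, hc, e⟩ := h b hb
    exact ⟨⟨(b, c), hb, hc, e⟩, rfl⟩
  obtain ⟨C, -, hC⟩ := f.exists_preimage_norm_le hf
  refine ⟨C, fun b hb => ?_⟩
  obtain ⟨⟨⟨b', c⟩, h1, h2, h3⟩, e, hn⟩ := hC ⟨b, hb⟩
  have hbb : b' = b := congrArg Subtype.val e
  subst hbb
  exact ⟨c, fun i => ⟨h2 i, (norm_le_pi_norm c i).trans ((norm_snd_le (b', c)).trans hn)⟩, h3⟩

end QN

/-! ### Vanishing of coefficients along infinitely many cosets -/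

section Coefficients

variable {G : Type*} [Group G]

/-- The restrictions of `y` to a sequence of distinct left cosets tend to zero. -/
theorem tendsto_norm_restrictTo_star {K : Subgroup G} {y : EllTwo G →L[ℂ] EllTwo G}
    (hy : y ∈ groupVN G) {s : ℕ → G} (hs : ∀ i j, (s i)⁻¹ * s j ∈ K → i = j) :
    Tendsto (fun k => ‖restrictTo (K : Set G) (star y (delta (s k)))‖) atTop (𝓝 0) := by
  -- The cosets `s_i K` are disjoint. The inverse on `K` matches the entries of `star y δ_s`, which
  -- at `x` are conjugates of `(y δ_1)(s x⁻¹)`.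
  have hinj : Function.Injective fun p : ℕ × K => s p.1 * (p.2 : G)⁻¹ := by
    rintro ⟨i, a⟩ ⟨j, b⟩ e
    simp only at e
    have hij : i = j := by
      refine hs i j ?_
      have : (s i)⁻¹ * s j = (a : G)⁻¹ * b := by
        rw [inv_mul_eq_iff_eq_mul, ← mul_assoc, e, inv_mul_cancel_right]
      rw [this]
      exact K.mul_mem (K.inv_mem a.2) b.2
    subst hij
    simpa using e
  -- The squared norms over the individual cosets form a summable series, so they tend to zero.
  have hsum := ((summable_norm_sq (y (delta 1))).comp_injective hinj).prod
  have hsq : ∀ k, ‖restrictTo (K : Set G) (star y (delta (s k)))‖ ^ 2 =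
      ∑' a : K, ‖(y (delta 1) : G → ℂ) (s k * (a : G)⁻¹)‖ ^ 2 := by
    intro k
    rw [norm_sq_eq_tsum, restrictTo_apply]
    have e : (fun x => ‖(K : Set G).indicator (star y (delta (s k)) : G → ℂ) x‖ ^ 2) =
        (K : Set G).indicator fun x => ‖(y (delta 1) : G → ℂ) (s k * x⁻¹)‖ ^ 2 := by
      funext x
      by_cases hx : x ∈ (K : Set G)
      · rw [Set.indicator_of_mem hx, Set.indicator_of_mem hx, star_apply_delta_apply,
          RCLike.norm_conj, apply_delta_apply hy]
      · rw [Set.indicator_of_notMem hx, Set.indicator_of_notMem hx, norm_zero]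
        norm_num
    rw [e, ← tsum_subtype]
    rfl
  have h0 := hsum.tendsto_atTop_zero
  simp only [Function.comp_def, ← hsq] at h0
  simpa using h0.sqrt

/-- The coefficient is `⟨y* δ_s, c δ_1⟩` and `c δ_1` lies in `ℓ²(K)`, so Cauchy–Schwarz only sees
the part of `y* δ_s` on `K`. -/
theorem norm_apply_delta_one_le {K : Subgroup G} (y : EllTwo G →L[ℂ] EllTwo G)
    {c : EllTwo G →L[ℂ] EllTwo G} (hc : c ∈ subgroupVN K) (s : G) :
    ‖((y * c) (delta 1) : G → ℂ) s‖ ≤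
      ‖restrictTo (K : Set G) (star y (delta s))‖ * ‖c‖ := by
  rw [mul_apply_eq_comp, ← inner_delta_left, ← ContinuousLinearMap.adjoint_inner_left,
    ← ContinuousLinearMap.star_eq_adjoint, ← restrictTo_apply_delta_one hc,
    inner_restrictTo_right]
  refine (norm_inner_le_norm _ _).trans ?_
  gcongr
  refine (c.le_opNorm _).trans ?_
  rw [norm_delta, mul_one]

/-- A one sided quasi-normalizer of `L(K)` has no coefficient at `g` if `K g` meets infinitely
many left cosets of `K`. -/
theorem coefficient_eq_zero {K : Subgroup G} {x : EllTwo G →L[ℂ] EllTwo G}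
    (hx : x ∈ oneSidedQN (subgroupVN K) (groupVN G)) {g : G} {u : ℕ → G} (hu : ∀ k, u k ∈ K)
    (hs : ∀ i j, (u i * g)⁻¹ * (u j * g) ∈ K → i = j) :
    (x (delta 1) : G → ℂ) g = 0 := by
  obtain ⟨-, n, y, hy, h⟩ := hx
  obtain ⟨C, hC⟩ := exists_bounded_coefficients _ x y h
  have hC0 : ∀ k, ‖(x (delta 1) : G → ℂ) g‖ ≤
      ∑ i, ‖restrictTo (K : Set G) (star (y i) (delta (u k * g)))‖ * |C| := by
    intro k
    obtain ⟨c, hc, e⟩ := hC _ (leftRegular_mem_subgroupVN (hu k))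
    have h1 : (x (delta 1) : G → ℂ) g =
        ∑ i, ((y i * c i) (delta 1) : G → ℂ) (u k * g) := by
      have h2 := congrArg (fun T => (T (delta 1) : G → ℂ) (u k * g)) e
      simp only [mul_apply_eq_comp, leftRegular_apply, inv_mul_cancel_left,
        _root_.sum_apply, lp.coeFn_sum, Finset.sum_apply] at h2
      exact h2
    rw [h1]
    refine (norm_sum_le _ _).trans (Finset.sum_le_sum fun i _ => ?_)
    refine (norm_apply_delta_one_le (y i) (hc i).1 _).trans ?_
    gcongr
    calc ‖c i‖ ≤ C * ‖leftRegular (u k)‖ := (hc i).2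
      _ ≤ |C| * 1 := by
        gcongr
        · exact le_abs_self C
        · exact norm_leftRegular_le _
      _ = |C| := mul_one _
  have hlim : Tendsto (fun k => ∑ i, ‖restrictTo (K : Set G) (star (y i) (delta (u k * g)))‖ * |C|)
      atTop (𝓝 0) := by
    have := tendsto_finsetSum Finset.univ fun i (_ : i ∈ Finset.univ) =>
      (tendsto_norm_restrictTo_star (hy i) hs).mul_const |C|
    simpa using this
  exact norm_le_zero_iff.1 (ge_of_tendsto' hlim hC0)

/-- Pigeonhole: finitely many cosets `y_i K` cannot contain all the `u_k g`. -/
theorem notMem_groupOneSidedQN {K : Subgroup G} {g : G} {u : ℕ → G} (hu : ∀ k, u k ∈ K)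
    (hs : ∀ i j, (u i * g)⁻¹ * (u j * g) ∈ K → i = j) : g ∉ groupOneSidedQN K := by
  rintro ⟨n, y, h⟩
  choose r hr using fun k => h (u k) (hu k)
  obtain ⟨i, j, hij, e⟩ := Finite.exists_ne_map_eq_of_infinite r
  obtain ⟨a, ha, e1⟩ := hr i
  obtain ⟨b, hb, e2⟩ := hr j
  refine hij (hs i j ?_)
  rw [e1, e2, e, mul_inv_rev, mul_assoc, inv_mul_cancel_left]
  exact K.mul_mem (K.inv_mem ha) hb

end Coefficients

/-! ### The shift example -/

namespace ShiftExample

theorem t_conj_mem {h : G} (hh : h ∈ H) : t * h * t⁻¹ ∈ H := by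
  have hle : H ≤ H.comap (MulAut.conj t).toMonoidHom := by
    refine (Subgroup.closure_le _).2 ?_
    rintro _ ⟨i, hi, rfl⟩
    refine Subgroup.subset_closure ⟨i + 1, by omega, ?_⟩
    rw [← t_mul_gen]
    rfl
  exact hle hh

theorem t_zpow_mul_gen (n i : ℤ) : t ^ n * gen i * (t ^ n)⁻¹ = gen (i + n) := by
  induction n with
  | zero => simp
  | succ n ih =>
    rw [add_comm (n : ℤ) 1, zpow_add, zpow_one]
    calc t * t ^ (n : ℤ) * gen i * (t * t ^ (n : ℤ))⁻¹
        = t * (t ^ (n : ℤ) * gen i * (t ^ (n : ℤ))⁻¹) * t⁻¹ := by group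
      _ = gen (i + (1 + n)) := by rw [ih, t_mul_gen]; congr 1; ring
  | pred n ih =>
    have key : t⁻¹ * gen (i + -n) * t = gen (i + (-n - 1)) := by
      have := t_mul_gen (i + (-n - 1))
      rw [show i + (-n - 1) + 1 = i + (-n : ℤ) by ring] at this
      rw [← this]
      group
    rw [← key, ← ih]
    group

/-- The degree `G → ℤ`, with kernel `F_∞`. -/
def degree : G →* Multiplicative ℤ := SemidirectProduct.rightHom

/-- The exponent sum of the generator `g_j`. -/
def exponentSum (j : ℤ) : FreeGroup ℤ →* Multiplicative ℤ :=
  FreeGroup.lift fun i => Multiplicative.ofAdd (if i = j then 1 else 0)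

/-- Elements of `H` have degree zero, and exponent sum zero in each `g_j` with `j < 0`. -/
theorem exponentSum_left_of_mem {h : G} (hh : h ∈ H) :
    h.right = 1 ∧ ∀ j < 0, exponentSum j h.left = 1 := by
  induction hh using Subgroup.closure_induction with
  | mem x hx =>
    obtain ⟨i, hi, rfl⟩ := hx
    refine ⟨rfl, fun j hj => ?_⟩
    simp [gen, exponentSum, show i ≠ j by omega]
  | one => exact ⟨rfl, fun j _ => by simp⟩
  | mul x y _ _ hx hy =>
    refine ⟨by rw [SemidirectProduct.mul_right, hx.1, hy.1, one_mul], fun j hj => ?_⟩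
    rw [SemidirectProduct.mul_left, hx.1, map_one, MulAut.one_apply, map_mul, hx.2 j hj,
      hy.2 j hj, one_mul]
  | inv x _ hx =>
    refine ⟨by rw [SemidirectProduct.inv_right, hx.1, inv_one], fun j hj => ?_⟩
    rw [SemidirectProduct.inv_left, hx.1, inv_one, map_one, MulAut.one_apply, map_inv, hx.2 j hj,
      inv_one]

/-- If `g` has positive degree then the left cosets `g_0 ^ k g H` are distinct. -/
theorem gen_pow_mul_injective {g : G} (hg : 0 < Multiplicative.toAdd (degree g)) (i j : ℕ)
    (h : (gen 0 ^ i * g)⁻¹ * (gen 0 ^ j * g) ∈ H) : i = j := by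
  set n := Multiplicative.toAdd (degree g) with hn
  obtain ⟨w, hw⟩ : ∃ w : FreeGroup ℤ, g = t ^ n * SemidirectProduct.inl w := by
    refine ⟨(t ^ (-n) * g).left, ?_⟩
    have h1 : (t ^ (-n) * g).right = 1 := by
      change degree (t ^ (-n) * g) = 1
      rw [map_mul, map_zpow]
      change Multiplicative.ofAdd (1 : ℤ) ^ (-n) * degree g = 1
      rw [← ofAdd_zsmul]
      apply Multiplicative.toAdd.injective
      simp [← hn]
    have h2 := SemidirectProduct.inl_left_mul_inr_right (t ^ (-n) * g)
    rw [h1, map_one, mul_one] at h2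
    rw [h2, zpow_neg, mul_inv_cancel_left]
  -- Positive degree shifts `g_0` to a negative index, outside the generators of `H`.
  have e0 : t ^ (-n) * gen 0 * t ^ n = gen (-n) := by
    have := t_zpow_mul_gen (-n) 0
    rwa [← zpow_neg, neg_neg, zero_add] at this
  have e1 : (gen 0 ^ i * g)⁻¹ * (gen 0 ^ j * g) =
      SemidirectProduct.inl (w⁻¹ * FreeGroup.of (-n) ^ ((j : ℤ) - i) * w) := by
    rw [map_mul, map_mul, map_zpow, map_inv]
    change _ = (SemidirectProduct.inl w)⁻¹ * gen (-n) ^ ((j : ℤ) - i) * SemidirectProduct.inl w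
    have e2 : gen (-n) ^ ((j : ℤ) - i) = t ^ (-n) * gen 0 ^ ((j : ℤ) - i) * t ^ n := by
      have := conj_zpow (i := (j : ℤ) - i) (a := t ^ (-n)) (b := gen 0)
      rw [← zpow_neg, neg_neg, e0] at this
      exact this
    rw [e2, hw]
    rw [sub_eq_neg_add, zpow_add, zpow_neg (gen 0), zpow_natCast, zpow_natCast, zpow_neg]
    simp only [mul_inv_rev, mul_assoc]
  rw [e1] at h
  -- Exponent sums ignore conjugation by `w`, so the exponent `j - i` of `g_{-n}` must vanish.
  have h3 := (exponentSum_left_of_mem h).2 (-n) (by omega)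
  rw [SemidirectProduct.left_inl, map_mul, map_mul, map_inv, map_zpow, mul_comm,
    mul_inv_cancel_left] at h3
  have h4 := congrArg Multiplicative.toAdd h3
  simp [exponentSum] at h4
  omega

theorem coefficient_eq_zero_of_degree_pos {x : EllTwo G →L[ℂ] EllTwo G}
    (hx : x ∈ oneSidedQN (subgroupVN H) (groupVN G)) {g : G}
    (hg : 0 < Multiplicative.toAdd (degree g)) : (x (delta 1) : G → ℂ) g = 0 :=
  coefficient_eq_zero hx (u := fun k => gen 0 ^ k)
    (fun k => H.pow_mem (Subgroup.subset_closure ⟨0, le_rfl, rfl⟩) k)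
    (gen_pow_mul_injective hg)

theorem coefficient_eq_zero_of_twoSidedQN {x : EllTwo G →L[ℂ] EllTwo G}
    (hx : x ∈ twoSidedQN (subgroupVN H) (groupVN G)) {g : G} (hg : g ∉ degree.ker) :
    (x (delta 1) : G → ℂ) g = 0 := by
  have hne : Multiplicative.toAdd (degree g) ≠ 0 := fun h => hg h
  rcases lt_or_gt_of_ne hne with h | h
  · have h1 := coefficient_eq_zero_of_degree_pos
      (twoSidedQN_subset_oneSidedQN _ _ (star_mem_twoSidedQN hx)) (g := g⁻¹)
      (by rw [map_inv, toAdd_inv]; omega)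
    -- The coefficient of `star x` at `g⁻¹` is the conjugate of that of `x` at `g`.
    rw [star_apply_delta_apply, apply_delta_apply hx.1, inv_inv, one_mul] at h1
    simpa using h1
  · exact coefficient_eq_zero_of_degree_pos (twoSidedQN_subset_oneSidedQN _ _ hx) h

theorem commute_restrictTo_of_twoSidedQN {x : EllTwo G →L[ℂ] EllTwo G}
    (hx : x ∈ twoSidedQN (subgroupVN H) (groupVN G)) :
    x * restrictTo (degree.ker : Set G) = restrictTo (degree.ker : Set G) * x :=
  restrictTo_commute hx.1 fun _ hg => coefficient_eq_zero_of_twoSidedQN hx hg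

theorem t_inv_notMem_ker : t⁻¹ ∉ degree.ker := by
  rw [inv_mem_iff, MonoidHom.mem_ker]
  intro h
  have h1 : (1 : ℤ) = 0 := congrArg Multiplicative.toAdd h
  omega

theorem leftRegular_t_inv_notMem :
    leftRegular t⁻¹ ∉ twoSidedQNAlgebra (subgroupVN H) (groupVN G) := by
  intro h
  have hc := mem_vonNeumannGenerated.1 h (restrictTo (degree.ker : Set G)) (by
    rw [Set.mem_centralizer_iff]
    rintro m (hm | hm)
    · exact commute_restrictTo_of_twoSidedQN hm
    · rw [← star_star m]
      exact commute_restrictTo_of_twoSidedQN (star_mem_twoSidedQN hm))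
  -- Projecting after translating kills `δ_{t⁻¹}`; projecting first fixes `δ_1` and leaves
  -- `δ_{t⁻¹}`.
  have h1 := congrArg (fun T => (T (delta 1) : G → ℂ) t⁻¹) hc
  simp only [mul_apply_eq_comp] at h1
  rw [restrictTo_delta_of_mem (s := (degree.ker : Set G)) (one_mem degree.ker),
    leftRegular_delta, mul_one,
    restrictTo_delta_of_notMem (s := (degree.ker : Set G)) t_inv_notMem_ker, delta_self] at h1
  exact zero_ne_one h1

theorem t_inv_mem_groupOneSidedQN : t⁻¹ ∈ groupOneSidedQN H :=
  ⟨1, fun _ => t⁻¹, fun h hh => ⟨0, t * h * t⁻¹, t_conj_mem hh, by group⟩⟩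

theorem t_notMem_groupOneSidedQN : t ∉ groupOneSidedQN H :=
  notMem_groupOneSidedQN (u := fun k => gen 0 ^ k)
    (fun k => H.pow_mem (Subgroup.subset_closure ⟨0, le_rfl, rfl⟩) k)
    (gen_pow_mul_injective (by change (0 : ℤ) < 1; norm_num))

end ShiftExample

theorem mainTheorem7 :
    (ShiftExample.t⁻¹ ∈ groupOneSidedQNClosure ShiftExample.H ∧
      ShiftExample.t⁻¹ ∉ groupQN ShiftExample.H) ∧
    groupQN ShiftExample.H < groupOneSidedQNClosure ShiftExample.H ∧
    twoSidedQNAlgebra (subgroupVN ShiftExample.H) (groupVN ShiftExample.G) <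
      oneSidedQNAlgebra (subgroupVN ShiftExample.H) (groupVN ShiftExample.G) := by
  have h1 : ShiftExample.t⁻¹ ∈ groupOneSidedQNClosure ShiftExample.H :=
    Subgroup.subset_closure ShiftExample.t_inv_mem_groupOneSidedQN
  have h2 : ShiftExample.t⁻¹ ∉ groupQN ShiftExample.H := fun h =>
    ShiftExample.t_notMem_groupOneSidedQN (inv_inv ShiftExample.t ▸ h.2)
  refine ⟨⟨h1, h2⟩, ?_, ?_⟩
  · exact SetLike.lt_iff_le_and_exists.2
      ⟨fun g hg => Subgroup.subset_closure hg.1, _, h1, h2⟩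
  · exact SetLike.lt_iff_le_and_exists.2
      ⟨vonNeumannGenerated_mono (twoSidedQN_subset_oneSidedQN _ _), _,
        subset_vonNeumannGenerated _
          (leftRegular_inv_mem_oneSidedQN fun _ hk => ShiftExample.t_conj_mem hk),
        ShiftExample.leftRegular_t_inv_notMem⟩
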